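/- Let $(M^{2n},J)$ be a smooth almost complex manifold of real dimension $2n$ with $n\ge 4$, let $N_J(X,Y)=[JX,JY]-J[X,JY]-J[JX,Y]-[X,Y]$ be its Nijenhuis tensor, and let $x\in M$ be a point with $N_J|_x\neq 0$. Let $\mathfrak g_x$ be either the Lie algebra of germs at $x$ of smooth infinitesimal symmetries of $J$ (the vector fields $X$ near $x$ with $L_XJ=0$, i.e. the stalk at $x$ of the Lie algebra sheaf of the pseudogroup $G=\mathrm{Sym}_{\mathrm{loc}}(M,J)$ of local symmetries), or the Lie algebra of formal infinitesimal symmetries at $x$ (the formal vector fields $X$ at $x$ for which $L_XJ$ vanishes to infinite order at $x$). For $i\ge 0$ let $g_i\subset S^iT_x^*M\otimes T_xM$ be the space of $i$-th order Taylor terms of those elements of $\mathfrak g_x$ whose $(i-1)$-jet at $x$ vanishes, and let $H(k)=\sum_{i\le k}\dim_{\mathbb R} g_i$, which is the dimension of the space of $k$-jets at $x$ of elements of $\mathfrak g_x$. We say that $G$ depends (at $x$) on at most $q$ complex functions of $p$ arguments (and possibly some functions of fewer arguments) if there are non-negative integers $c_0,\dots,c_{p-1}$ with $$H(k)\le 2\Big(q\binom{k+p}{p}+\sum_{j<p}c_j\binom{k+j}{j}\Big)\qquad\text{for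 all }k\ge 0 .$$ Then $G$ depends on at most $n-2$ complex functions of $n-1$ arguments. Moreover, this bound is achieved, in the sense that $G$ does not depend on at most $n-3$ complex functions of $n-1$ arguments, only if the image $\operatorname{Im}N_J|_x\subset T_xM$ is a complex line and $N_J|_x$ has complex rank $2$ as a 2-form, i.e. its kernel $\{u\in T_xM: N_J(u,\cdot)=0\}$ has complex codimension $2$. -/

import Mathlib

open Set Filter Topology
open scoped Manifold ContDiff

noncomputable section

/-! ### Local calculus of a field of endomorphisms in a coordinate space

`E` is the coordinate space, `J : E → E →L[ℝ] E` a field of endomorphisms of the tangent spaces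
(the coordinate expression of an almost complex structure), and vector fields are maps `E → E`.
Only the germs at the point under consideration matter. -/

section Local

variable {E : Type*} [NormedAddCommGroup E] [NormedSpace ℝ E]

/-- The Nijenhuis bracket of two vector fields,
`N_J(X, Y) = [JX, JY] - J[X, JY] - J[JX, Y] - [X, Y]`. -/
def nijenhuis (J : E → E →L[ℝ] E) (X Y : E → E) (p : E) : E :=
  VectorField.lieBracket ℝ (fun q => J q (X q)) (fun q => J q (Y q)) p
    - J p (VectorField.lieBracket ℝ X (fun q => J q (Y q)) p)
    - J p (VectorField.lieBracket ℝ (fun q => J q (X q)) Y p)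
    - VectorField.lieBracket ℝ X Y p

/-- The Nijenhuis tensor at the point `p`. As `nijenhuis` is tensorial, its value on two tangent
vectors is computed with their constant extensions. -/
def nijenhuisAt (J : E → E →L[ℝ] E) (p u v : E) : E :=
  nijenhuis J (fun _ => u) (fun _ => v) p

/-- The image `W = Im N_J` at `p`: the subspace of the tangent space spanned by all values
of the Nijenhuis tensor (it is `J`-invariant, because `N_J` is `J`-antilinear). -/
def nijenhuisImage (J : E → E →L[ℝ] E) (p : E) : Submodule ℝ E :=
  Submodule.span ℝ {w | ∃ u v, w = nijenhuisAt J p u v}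

/-- The kernel `Z = {u | N_J(u, ·) = 0}` of the Nijenhuis tensor at `p` (a `J`-invariant
subspace). -/
def nijenhuisKernel (J : E → E →L[ℝ] E) (p : E) : Submodule ℝ E :=
  Submodule.span ℝ {u | ∀ v, nijenhuisAt J p u v = 0}

/-- `N_J` has complex rank `r` as a skew-symmetric form at `p`: its kernel has complex
codimension `r`, i.e. real codimension `2 r`. -/
def NijenhuisHasComplexRank (J : E → E →L[ℝ] E) (p : E) (r : ℕ) : Prop :=
  Module.finrank ℝ (E ⧸ nijenhuisKernel J p) = 2 * r

/-- The image of `N_J` at `p` is a complex line of the tangent space. -/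
def NijenhuisImageIsComplexLine (J : E → E →L[ℝ] E) (p : E) : Prop :=
  ∃ w : E, w ≠ 0 ∧ nijenhuisImage J p = Submodule.span ℝ {w, J p w}

/-- The Lie derivative of `J` along `X`, `(L_X J) Y = [X, JY] - J[X, Y]`. It is tensorial in `Y`,
so it is evaluated on a tangent vector `v` through its constant extension. -/
def lieDerivEndo (J : E → E →L[ℝ] E) (X : E → E) (v p : E) : E :=
  VectorField.lieBracket ℝ X (fun q => J q v) p
    - J p (VectorField.lieBracket ℝ X (fun _ => v) p)

/-- The local infinitesimal symmetries of `J` at `p` (the stalk at `p` of the Lie algebra sheaf of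
the pseudogroup of local symmetries): smooth vector fields near `p` with `L_X J = 0` near `p`. -/
def localSymmetries (J : E → E →L[ℝ] E) (p : E) : Set (E → E) :=
  {X | (∀ᶠ q in 𝓝 p, ContDiffAt ℝ ∞ X q) ∧ ∀ᶠ q in 𝓝 p, ∀ v, lieDerivEndo J X v q = 0}

/-- The formal infinitesimal symmetries of `J` at `p`, i.e. the formal solutions at `p` of the Lie
equation `L_X J = 0`: the vector fields such that `L_X J` vanishes to infinite order at `p`.
(Only the Taylor series of `X` at `p` matters, and each formal series is one of a smooth field.) -/
def formalSymmetries (J : E → E →L[ℝ] E) (p : E) : Set (E → E) :=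
  {X | ContDiffAt ℝ ∞ X p ∧ ∀ (v : E) (m : ℕ), iteratedFDeriv ℝ m (lieDerivEndo J X v) p = 0}

/-- The symbol `g_k ⊆ S^k T* ⊗ T` at `p` of a linear space `S` of vector fields: the `k`-th order
Taylor terms at `p` of the members of `S` whose `(k-1)`-jet at `p` vanishes. -/
def symbolSpace (S : Set (E → E)) (p : E) (k : ℕ) :
    Submodule ℝ (ContinuousMultilinearMap ℝ (fun _ : Fin k => E) E) :=
  Submodule.span ℝ {T | ∃ X ∈ S, (∀ j < k, iteratedFDeriv ℝ j X p = 0) ∧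
    iteratedFDeriv ℝ k X p = T}

/-- The Hilbert function `k ↦ ∑_{i ≤ k} dim g_i`, i.e. the real dimension of the space of `k`-jets
at `p` of the members of `S`. -/
def hilbertFunction (S : Set (E → E)) (p : E) (k : ℕ) : ℕ :=
  ∑ i ∈ Finset.range (k + 1), Module.finrank ℝ (symbolSpace S p i)

end Local

/-- A space of jets with Hilbert function `H` (real dimensions) depends on at most `q` complex
functions of `p` complex arguments (and some number `c j` of complex functions of `j < p`
arguments): the `k`-jets of one complex function of `j` complex arguments form a space of complex
dimension `(k + j).choose j`. If `H` is eventually a polynomial, this says that its degree is at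
most `p` and that its coefficient at `k ^ p` is at most `2 q / p!`. -/
def DependsOnAtMost (H : ℕ → ℕ) (q p : ℕ) : Prop :=
  ∃ c : Fin p → ℕ, ∀ k : ℕ,
    H k ≤ 2 * (q * (k + p).choose p + ∑ j : Fin p, c j * (k + (j : ℕ)).choose (j : ℕ))

/-! ### Almost complex manifolds -/

section Global

/-- A smooth almost complex structure on a manifold `M` modelled on `E`: a smooth section `J` of
the bundle of endomorphisms of the tangent bundle with `J² = -1`. -/
structure AlmostComplexStructure (E : Type*) [NormedAddCommGroup E] [NormedSpace ℝ E]
    (M : Type*) [TopologicalSpace M] [ChartedSpace E M] [IsManifold 𝓘(ℝ, E) ∞ M] where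
  /-- The endomorphism of each tangent space. -/
  endo : ∀ x : M, TangentSpace 𝓘(ℝ, E) x →L[ℝ] TangentSpace 𝓘(ℝ, E) x
  sq_eq_neg : ∀ (x : M) (v : TangentSpace 𝓘(ℝ, E) x), endo x (endo x v) = -v
  smooth : ContMDiff 𝓘(ℝ, E) (𝓘(ℝ, E).prod 𝓘(ℝ, E →L[ℝ] E)) ∞
    (fun x => Bundle.TotalSpace.mk' (E →L[ℝ] E)
      (E := fun x : M => TangentSpace 𝓘(ℝ, E) x →L[ℝ] TangentSpace 𝓘(ℝ, E) x) x (endo x))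

/-- The coordinate expression of an almost complex structure in the chart at `x`. -/
def AlmostComplexStructure.inChart {E : Type*} [NormedAddCommGroup E] [NormedSpace ℝ E]
    {M : Type*} [TopologicalSpace M] [ChartedSpace E M] [IsManifold 𝓘(ℝ, E) ∞ M]
    (J : AlmostComplexStructure E M) (x : M) : E → E →L[ℝ] E := fun p =>
  (mfderiv 𝓘(ℝ, E) 𝓘(ℝ, E) (extChartAt 𝓘(ℝ, E) x) ((extChartAt 𝓘(ℝ, E) x).symm p)).comp
    ((J.endo ((extChartAt 𝓘(ℝ, E) x).symm p)).comp
      (mfderiv 𝓘(ℝ, E) 𝓘(ℝ, E) (extChartAt 𝓘(ℝ, E) x).symm p))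

end Global

end

/-! Let `T` be the leading Taylor term, of order `k ≥ 2`, of a symmetry whose lower jets vanish at
the point. The first nontrivial derivative of `L_X J = 0` says that `T` is complex linear in every
slot. The next one, suitably combined, says that every contraction `B` of `T` to an endomorphism is
a derivation of the bracket `N = N_J` (`iteratedFDeriv_mem_annihilatingSymbols`). As `k ≥ 2`, the
endomorphism `J B` is again such a contraction. Since `N` is complex antilinear, comparing the two
derivation rules makes both sides vanish: `T` kills `W = Im N`, and `N (T (.., x)) y` is symmetric
in `x` and `y` (`mem_annihilatingSymbols_of_derivation`).

Hence `T` is a symmetric complex form on `E / W`. If `W` has complex dimension at least `2`, the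
growth is that of functions of at most `n - 2` arguments. Otherwise `W` is a complex line, and `T`
is split by its contraction `N (T ..) y` (`finrank_annihilatingSymbols_le_add`). The kernel consists
of forms on `E / W` with values in `Z = ker N`. The image consists of totally symmetric antilinear
forms of degree `k + 1` with values in the line `W`, and these vanish both on `W` and on `Z`.

With values in a line, `N` has complex rank `2` or at least `4` (`finrank_quotient_ker_eq_four_or`).
In rank `2` the kernel contributes `n - 2` functions of `n - 1` arguments, and the image, living on
the plane `E / Z`, only functions of two arguments. In rank at least `4` the kernel contributes at
most `n - 4` and the image, counted on `E / W`, at most one more: `n - 3` in all. -/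

/-! ### Symmetric multilinear maps -/

/-- A function of tuples which is invariant under transpositions is symmetric. -/
theorem comp_perm_of_comp_swap {ι α β : Type*} [Finite ι] [DecidableEq ι] {f : (ι → α) → β}
    (h : ∀ v a b, a ≠ b → f (v ∘ Equiv.swap a b) = f v) (σ : Equiv.Perm ι) (v : ι → α) :
    f (v ∘ σ) = f v := by
  induction σ using Equiv.Perm.swap_induction_on generalizing v with
  | one => rfl
  | swap_mul σ a b hab ih =>
    have : v ∘ (Equiv.swap a b * σ : Equiv.Perm ι) = (v ∘ Equiv.swap a b) ∘ σ := rfl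
    rw [this, ih, h _ _ _ hab]

/-- A function of tuples which is invariant under adjacent transpositions is symmetric. -/
theorem comp_perm_of_comp_adjacent_swap {k : ℕ} {α β : Type*} {f : (Fin (k + 1) → α) → β}
    (h : ∀ v (i : Fin k), f (v ∘ Equiv.swap i.castSucc i.succ) = f v)
    (σ : Equiv.Perm (Fin (k + 1))) (v : Fin (k + 1) → α) : f (v ∘ σ) = f v := by
  have hσ : σ ∈ Submonoid.closure (Set.range fun i : Fin k ↦ Equiv.swap i.castSucc i.succ) := by
    rw [Equiv.Perm.mclosure_swap_castSucc_succ]; trivial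
  induction hσ using Submonoid.closure_induction_left generalizing v with
  | one => rfl
  | mul_left τ hτ σ _ ih =>
    obtain ⟨i, rfl⟩ := hτ
    have : v ∘ (Equiv.swap i.castSucc i.succ * σ : Equiv.Perm _)
        = (v ∘ Equiv.swap i.castSucc i.succ) ∘ σ := rfl
    rw [this]
    exact (ih _).trans (h _ _)

/-- Two tuples with the same multiset of values are permutations of each other. -/
theorem exists_comp_perm_of_perm_ofFn {k m : ℕ} {t t' : Fin k → Fin m}
    (h : (List.ofFn t).Perm (List.ofFn t')) : ∃ σ : Equiv.Perm (Fin k), t ∘ σ = t' := by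
  have key : t ∘ Tuple.sort t = t' ∘ Tuple.sort t' := by
    refine List.ofFn_injective (List.Perm.eq_of_pairwise'
      (Tuple.monotone_sort t).sortedLE_ofFn.pairwise
      (Tuple.monotone_sort t').sortedLE_ofFn.pairwise ?_)
    exact ((Equiv.Perm.ofFn_comp_perm _ _).trans h).trans (Equiv.Perm.ofFn_comp_perm _ _).symm
  refine ⟨(Tuple.sort t').symm.trans (Tuple.sort t), ?_⟩
  funext i
  have := congrFun key ((Tuple.sort t').symm i)
  simpa using this

/-- A multilinear map which is compatible with an endomorphism in every slot, vanishes on `U` and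
on a family generating the space modulo `U`, is zero. -/
theorem multilinearMap_eq_zero_of_generating {k : ℕ} {ι E F : Type*}
    [AddCommGroup E] [Module ℝ E] [AddCommGroup F] [Module ℝ F]
    (T : MultilinearMap ℝ (fun _ : Fin k => E) F) (J : E →ₗ[ℝ] E) (J' : F →ₗ[ℝ] F)
    (U : Submodule ℝ E) (e : ι → E)
    (hspan : U ⊔ Submodule.span ℝ (range e ∪ range (fun i => J (e i))) = ⊤)
    (hJ : ∀ v i x, T (Function.update v i (J x)) = J' (T (Function.update v i x)))
    (hU : ∀ v i, ∀ x ∈ U, T (Function.update v i x) = 0)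
    (he : ∀ s : Fin k → ι, T (e ∘ s) = 0) : T = 0 := by
  have key : ∀ j : ℕ, ∀ v, (∀ i : Fin k, j ≤ i.val → ∃ m, v i = e m) → T v = 0 := by
    -- The slots below `j` are arbitrary and the others carry generators; each step frees one more
    -- slot by linearity.
    intro j
    induction j with
    | zero =>
      intro v hv
      choose s hs using fun i => hv i (Nat.zero_le _)
      have : v = e ∘ s := funext hs
      rw [this, he]
    | succ j ih =>
      intro v hv
      by_cases hj : j < k
      · have h1 : ∀ m, T (Function.update v ⟨j, hj⟩ (e m)) = 0 := by
          intro m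
          refine ih _ fun i hi => ?_
          by_cases hij : i = ⟨j, hj⟩
          · subst hij; exact ⟨m, by simp⟩
          · rw [Function.update_of_ne hij]
            refine hv i (lt_of_le_of_ne hi fun h => hij (Fin.ext h.symm))
        have h2 : ⊤ ≤ LinearMap.ker (T.toLinearMap v ⟨j, hj⟩) := by
          rw [← hspan]
          refine sup_le (fun x hx => hU v _ x hx) (Submodule.span_le.2 ?_)
          rintro _ (⟨m, rfl⟩ | ⟨m, rfl⟩)
          · exact h1 m
          · change T (Function.update v ⟨j, hj⟩ (J (e m))) = 0
            rw [hJ, h1, map_zero]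
        have h3 : T (Function.update v ⟨j, hj⟩ (v ⟨j, hj⟩)) = 0 :=
          h2 (Submodule.mem_top : v ⟨j, hj⟩ ∈ ⊤)
        simpa using h3
      · exact ih v fun i hi => absurd (lt_of_le_of_lt hi i.2) hj
  ext v
  exact key k v fun i hi => absurd i.2 (not_lt.2 hi)

/-- A space of symmetric multilinear maps with values in `R`, which are compatible with an
endomorphism in every slot and vanish on `U`, has dimension at most `dim R` times the number of
monomials in the generators modulo `U`. -/
theorem finrank_le_multichoose_mul {k m : ℕ} {E F : Type*}
    [AddCommGroup E] [Module ℝ E] [AddCommGroup F] [Module ℝ F] [FiniteDimensional ℝ F]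
    (A : Submodule ℝ (MultilinearMap ℝ (fun _ : Fin k => E) F)) (J : E →ₗ[ℝ] E) (J' : F →ₗ[ℝ] F)
    (U : Submodule ℝ E) (R : Submodule ℝ F) (e : Fin m → E)
    (hspan : U ⊔ Submodule.span ℝ (range e ∪ range (fun i => J (e i))) = ⊤)
    (hR : ∀ T ∈ A, ∀ v, T v ∈ R)
    (hsymm : ∀ T ∈ A, ∀ (σ : Equiv.Perm (Fin k)) v, T (v ∘ σ) = T v)
    (hJ : ∀ T ∈ A, ∀ v i x, T (Function.update v i (J x)) = J' (T (Function.update v i x)))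
    (hU : ∀ T ∈ A, ∀ v i, ∀ x ∈ U, T (Function.update v i x) = 0) :
    Module.finrank ℝ A ≤ m.multichoose k * Module.finrank ℝ R := by
  classical
  let toSym : (Fin k → Fin m) → Sym (Fin m) k := fun t => ⟨(List.ofFn t : Multiset _), by simp⟩
  have hsurj : Function.Surjective toSym := by
    rintro ⟨s, hs⟩
    obtain ⟨l, rfl⟩ := Quot.exists_rep s
    have hl : l.length = k := hs
    subst hl
    exact ⟨l.get, Subtype.ext (congrArg (fun l : List (Fin m) => (l : Multiset (Fin m)))
      (List.ofFn_get l))⟩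
  choose rep hrep using hsurj
  -- Evaluation at one representative tuple per multiset of generators; symmetry makes it injective.
  let Φ : A →ₗ[ℝ] (Sym (Fin m) k → R) :=
    { toFun := fun T s => ⟨T.1 (e ∘ rep s), hR _ T.2 _⟩
      map_add' := fun _ _ => rfl
      map_smul' := fun _ _ => rfl }
  have hΦ : Function.Injective Φ := by
    rw [← LinearMap.ker_eq_bot, LinearMap.ker_eq_bot']
    rintro ⟨T, hT⟩ h0
    refine Subtype.ext (multilinearMap_eq_zero_of_generating T J J' U e hspan (hJ T hT) (hU T hT)
      fun t => ?_)
    have h1 : (List.ofFn (rep (toSym t))).Perm (List.ofFn t) :=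
      Multiset.coe_eq_coe.1 (congrArg Subtype.val (hrep (toSym t)))
    obtain ⟨σ, hσ⟩ := exists_comp_perm_of_perm_ofFn h1
    have h2 : T (e ∘ rep (toSym t)) = 0 := congrArg Subtype.val (congrFun h0 (toSym t))
    rw [← hσ, ← Function.comp_assoc, hsymm T hT, h2]
  have h := LinearMap.finrank_le_finrank_of_injective hΦ
  rw [Module.finrank_pi_fintype] at h
  simpa [Sym.card_sym_eq_multichoose] using h

/-- A space with a complex structure has even dimension, and it is generated over the complex
numbers by half as many vectors. -/
theorem exists_complex_generators {V : Type*} [AddCommGroup V] [Module ℝ V] [FiniteDimensional ℝ V]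
    (I : V →ₗ[ℝ] V) (hI : ∀ v, I (I v) = -v) :
    ∃ (m : ℕ) (e : Fin m → V), Module.finrank ℝ V = 2 * m ∧
      Submodule.span ℝ (range e ∪ range (fun i => I (e i))) = ⊤ := by
  let φ : ℂ →ₐ[ℝ] Module.End ℝ V := Complex.lift ⟨I, by ext v; simp [hI]⟩
  let _ : Module ℂ V := Module.compHom V φ.toRingHom
  have hsmul : ∀ (z : ℂ) (v : V), z • v = z.re • v + z.im • I v := by
    intro z v
    change φ z v = _
    simp [φ, Complex.liftAux_apply]
  have : IsScalarTower ℝ ℂ V := ⟨fun r z v => by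
    rw [hsmul, hsmul]; simp [smul_add, mul_smul]⟩
  have : FiniteDimensional ℂ V := FiniteDimensional.right ℝ ℂ V
  let b := Module.finBasis ℂ V
  refine ⟨_, b, ?_, ?_⟩
  · rw [← Module.finrank_mul_finrank ℝ ℂ V, Complex.finrank_real_complex]
  rw [eq_top_iff]
  rintro v -
  rw [← b.sum_repr v]
  refine Submodule.sum_mem _ fun i _ => ?_
  rw [hsmul]
  refine Submodule.add_mem _ (Submodule.smul_mem _ _ (Submodule.subset_span (Or.inl ⟨i, rfl⟩)))
    (Submodule.smul_mem _ _ (Submodule.subset_span (Or.inr ⟨i, rfl⟩)))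

/-- The complex codimension of an invariant subspace `U`, and a family of that many vectors which
generates the space modulo `U`. -/
theorem exists_complex_generators_mod {V : Type*} [AddCommGroup V] [Module ℝ V]
    [FiniteDimensional ℝ V] (I : V →ₗ[ℝ] V) (hI : ∀ v, I (I v) = -v) (U : Submodule ℝ V)
    (hU : ∀ u ∈ U, I u ∈ U) :
    ∃ (m : ℕ) (e : Fin m → V), Module.finrank ℝ (V ⧸ U) = 2 * m ∧
      U ⊔ Submodule.span ℝ (range e ∪ range (fun i => I (e i))) = ⊤ := by
  obtain ⟨m, e, hm, he⟩ := exists_complex_generators (U.mapQ U I hU) (by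
    intro v
    obtain ⟨v, rfl⟩ := U.mkQ_surjective v
    simp [hI])
  choose f hf using fun i => U.mkQ_surjective (e i)
  refine ⟨m, f, hm, ?_⟩
  have h1 : Submodule.map U.mkQ (Submodule.span ℝ (range f ∪ range (fun i => I (f i)))) = ⊤ := by
    rw [Submodule.map_span, Set.image_union, ← Set.range_comp, ← Set.range_comp, ← he]
    congr 3
    · exact funext hf
    · refine funext fun i => ?_
      rw [← hf i]; simp
  have h2 := congrArg (Submodule.comap U.mkQ) h1
  rwa [Submodule.comap_map_mkQ, Submodule.comap_top] at h2

/-! ### Symbols of symmetries, algebraically -/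

section Symbols

variable {E : Type*} [AddCommGroup E] [Module ℝ E]

theorem eq_zero_of_eq_neg_self {x : E} (h : x = -x) : x = 0 := by
  have h2 : (2 : ℝ) • x = 0 := by
    rw [two_smul]; nth_rewrite 1 [h]; exact neg_add_cancel x
  exact (smul_eq_zero.1 h2).resolve_left two_ne_zero

theorem antilinear_right_of_left {J : E →ₗ[ℝ] E} {N : E →ₗ[ℝ] E →ₗ[ℝ] E}
    (hNJ : ∀ u v, N (J u) v = -J (N u v)) (hskew : ∀ u v, N u v = -N v u) (u v : E) :
    N u (J v) = -J (N u v) := by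
  rw [hskew, hNJ, hskew v u, map_neg, neg_neg]

/-- The symmetric multilinear maps, complex linear in every slot, all of whose contractions to
endomorphisms annihilate the image of `N` and act on `N` by `0`. -/
def annihilatingSymbols (J : E →ₗ[ℝ] E) (N : E →ₗ[ℝ] E →ₗ[ℝ] E) (k : ℕ) :
    Submodule ℝ (MultilinearMap ℝ (fun _ : Fin k => E) E) where
  carrier := {T | (∀ (σ : Equiv.Perm (Fin k)) v, T (v ∘ σ) = T v) ∧
    (∀ v i x, T (Function.update v i (J x)) = J (T (Function.update v i x))) ∧
    (∀ v i x y, T (Function.update v i (N x y)) = 0) ∧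
    ∀ v i x y, N (T (Function.update v i x)) y = N (T (Function.update v i y)) x}
  add_mem' := by
    rintro S T ⟨h1, h2, h3, h4⟩ ⟨k1, k2, k3, k4⟩
    refine ⟨fun σ v => ?_, fun v i x => ?_, fun v i x y => ?_, fun v i x y => ?_⟩ <;>
      simp only [add_apply, map_add, LinearMap.add_apply]
    · rw [h1, k1]
    · rw [h2, k2]
    · rw [h3, k3, add_zero]
    · rw [h4, k4]
  zero_mem' := by simp
  smul_mem' := by
    rintro c T ⟨h1, h2, h3, h4⟩
    refine ⟨fun σ v => ?_, fun v i x => ?_, fun v i x y => ?_, fun v i x y => ?_⟩ <;>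
      simp only [smul_apply, map_smul, LinearMap.smul_apply]
    · rw [h1]
    · rw [h2]
    · rw [h3, smul_zero]
    · rw [h4]

/-- A symmetric multilinear map with at least two slots, complex linear in every slot, whose
contractions to endomorphisms are derivations of the complex antilinear bracket `N`. -/
theorem mem_annihilatingSymbols_of_derivation {J : E →ₗ[ℝ] E} {N : E →ₗ[ℝ] E →ₗ[ℝ] E}
    (hJ : ∀ v, J (J v) = -v) (hNJ : ∀ u v, N (J u) v = -J (N u v)) (hskew : ∀ u v, N u v = -N v u)
    {k : ℕ} (hk : 2 ≤ k) {T : MultilinearMap ℝ (fun _ : Fin k => E) E}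
    (hsymm : ∀ (σ : Equiv.Perm (Fin k)) v, T (v ∘ σ) = T v)
    (hTJ : ∀ v i x, T (Function.update v i (J x)) = J (T (Function.update v i x)))
    (hder : ∀ v i x y, T (Function.update v i (N x y)) =
      N (T (Function.update v i x)) y + N x (T (Function.update v i y))) :
    T ∈ annihilatingSymbols J N k := by
  -- Inserting `J` in a second slot `j` turns the contraction `B` into `J B`. Its derivation rule
  -- gives `J B (N x y) = -J (B (N x y))`, by antilinearity of `N`.
  have h0 : ∀ v i x y, T (Function.update v i (N x y)) = 0 := by
    intro v i x y
    have : Nontrivial (Fin k) := Fin.nontrivial_iff_two_le.2 hk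
    obtain ⟨j, hj⟩ := exists_ne i
    have hB : ∀ z, T (Function.update (Function.update v j (J (v j))) i z)
        = J (T (Function.update v i z)) := by
      intro z
      rw [Function.update_comm hj, hTJ]
      congr 2
      rw [Function.update_comm hj.symm, Function.update_eq_self]
    have h1 := hder (Function.update v j (J (v j))) i x y
    have hNJ' := antilinear_right_of_left hNJ hskew
    rw [hB, hB, hB, hNJ, hNJ', ← neg_add, ← map_add, ← hder] at h1
    have h2 : J (T (Function.update v i (N x y))) = 0 := eq_zero_of_eq_neg_self h1
    have h3 := hJ (T (Function.update v i (N x y)))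
    rw [h2, map_zero] at h3
    exact neg_eq_zero.1 h3.symm
  refine ⟨hsymm, hTJ, h0, fun v i x y => ?_⟩
  have h := hder v i x y
  rw [h0, hskew x] at h
  exact (eq_of_sub_eq_zero (by rw [sub_eq_add_neg]; exact h.symm))

theorem map_update_eq_zero_of_mem_span {J : E →ₗ[ℝ] E} {N : E →ₗ[ℝ] E →ₗ[ℝ] E} {k : ℕ}
    {T : MultilinearMap ℝ (fun _ : Fin k => E) E} (hT : T ∈ annihilatingSymbols J N k)
    (v : Fin k → E) (i : Fin k) {x : E} (hx : x ∈ Submodule.span ℝ {w | ∃ u v, w = N u v}) :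
    T (Function.update v i x) = 0 := by
  have h : Submodule.span ℝ {w | ∃ u v, w = N u v} ≤ LinearMap.ker (T.toLinearMap v i) := by
    rw [Submodule.span_le]
    rintro _ ⟨x, y, rfl⟩
    exact hT.2.2.1 v i x y
  exact h hx

/-- Contraction of `N` with a multilinear map. -/
def contractWith (N : E →ₗ[ℝ] E →ₗ[ℝ] E) (k : ℕ) :
    MultilinearMap ℝ (fun _ : Fin k => E) E →ₗ[ℝ]
      MultilinearMap ℝ (fun _ : Fin (k + 1) => E) E where
  toFun T := MultilinearMap.uncurryRight (M := fun _ : Fin (k + 1) => E) (N.compMultilinearMap T)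
  map_add' S T := by ext v; simp
  map_smul' c T := by ext v; simp

theorem contractWith_apply (N : E →ₗ[ℝ] E →ₗ[ℝ] E) (k : ℕ)
    (T : MultilinearMap ℝ (fun _ : Fin k => E) E) (v : Fin (k + 1) → E) :
    contractWith N k T v = N (T (Fin.init v)) (v (Fin.last k)) := rfl

theorem contractWith_update_castSucc (N : E →ₗ[ℝ] E →ₗ[ℝ] E) (k : ℕ)
    (T : MultilinearMap ℝ (fun _ : Fin k => E) E) (v : Fin (k + 1) → E) (i : Fin k) (x : E) :
    contractWith N k T (Function.update v i.castSucc x)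
      = N (T (Function.update (Fin.init v) i x)) (v (Fin.last k)) := by
  rw [contractWith_apply, Function.update_of_ne (Fin.castSucc_lt_last i).ne']
  congr 3
  exact Fin.init_update_castSucc ..

theorem contractWith_update_last (N : E →ₗ[ℝ] E →ₗ[ℝ] E) (k : ℕ)
    (T : MultilinearMap ℝ (fun _ : Fin k => E) E) (v : Fin (k + 1) → E) (x : E) :
    contractWith N k T (Function.update v (Fin.last k) x) = N (T (Fin.init v)) x := by
  rw [contractWith_apply, Fin.init_update_last, Function.update_self]

/-- A transposition either stays within the slots of `T`, where `T` is symmetric, or involves the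
last slot, where the exchange law of `annihilatingSymbols` applies. -/
theorem contractWith_comp_perm {J : E →ₗ[ℝ] E} {N : E →ₗ[ℝ] E →ₗ[ℝ] E} {k : ℕ}
    {T : MultilinearMap ℝ (fun _ : Fin k => E) E} (hT : T ∈ annihilatingSymbols J N k)
    (σ : Equiv.Perm (Fin (k + 1))) (v : Fin (k + 1) → E) :
    contractWith N k T (v ∘ σ) = contractWith N k T v := by
  have hlast : ∀ (v : Fin (k + 1) → E) (i : Fin k),
      contractWith N k T (v ∘ Equiv.swap i.castSucc (Fin.last k)) = contractWith N k T v := by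
    intro v i
    have h1 : Fin.init (v ∘ Equiv.swap i.castSucc (Fin.last k))
        = Function.update (Fin.init v) i (v (Fin.last k)) := by
      funext j
      by_cases hj : j = i
      · subst hj; simp [Fin.init]
      · rw [Function.update_of_ne hj]
        simp only [Fin.init, Function.comp]
        rw [Equiv.swap_apply_of_ne_of_ne (by simpa using hj) (Fin.castSucc_lt_last j).ne]
    rw [contractWith_apply, contractWith_apply, h1, hT.2.2.2]
    simp only [Function.comp, Equiv.swap_apply_right]
    have : v i.castSucc = Fin.init v i := rfl
    rw [this, Function.update_eq_self]
  refine comp_perm_of_comp_swap (f := fun v => contractWith N k T v) (fun v a b hab => ?_) σ v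
  induction a using Fin.lastCases with
  | last =>
    induction b using Fin.lastCases with
    | last => exact absurd rfl hab
    | cast b => rw [Equiv.swap_comm]; exact hlast v b
  | cast a =>
    induction b using Fin.lastCases with
    | last => exact hlast v a
    | cast b =>
      have h1 : Fin.init (v ∘ Equiv.swap a.castSucc b.castSucc)
          = Fin.init v ∘ Equiv.swap a b := by
        funext j
        simp only [Fin.init, Function.comp]
        rw [← (Fin.castSucc_injective k).swap_apply]
      simp only [contractWith_apply]
      rw [h1, hT.1]
      simp only [Function.comp]
      rw [Equiv.swap_apply_of_ne_of_ne (Fin.castSucc_lt_last a).ne' (Fin.castSucc_lt_last b).ne']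

variable [FiniteDimensional ℝ E]

/-- Every symbol is determined by its values on the monomials modulo the image of `N`. -/
theorem finrank_annihilatingSymbols_le {J : E →ₗ[ℝ] E} {N : E →ₗ[ℝ] E →ₗ[ℝ] E} {k m : ℕ}
    (e : Fin m → E)
    (he : Submodule.span ℝ {w | ∃ u v, w = N u v} ⊔
      Submodule.span ℝ (range e ∪ range (fun i => J (e i))) = ⊤) :
    Module.finrank ℝ (annihilatingSymbols J N k) ≤ m.multichoose k * Module.finrank ℝ E := by
  have h := finrank_le_multichoose_mul (annihilatingSymbols J N k) J J _ ⊤ e he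
    (fun _ _ _ => trivial) (fun T hT => hT.1) (fun T hT => hT.2.1)
    (fun T hT v i x hx => map_update_eq_zero_of_mem_span hT v i hx)
  rwa [finrank_top] at h

/-- The symbols with values in the kernel of `N` are counted by the monomials modulo the image of
`N`; the remaining ones by their contractions with `N`, which are totally symmetric. -/
theorem finrank_annihilatingSymbols_le_add {J : E →ₗ[ℝ] E} {N : E →ₗ[ℝ] E →ₗ[ℝ] E}
    (hNJ : ∀ u v, N (J u) v = -J (N u v)) (hskew : ∀ u v, N u v = -N v u)
    {k m l : ℕ} (hk : 0 < k) (e : Fin m → E)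
    (he : Submodule.span ℝ {w | ∃ u v, w = N u v} ⊔
      Submodule.span ℝ (range e ∪ range (fun i => J (e i))) = ⊤)
    (U : Submodule ℝ E) (hU : U ≤ Submodule.span ℝ {w | ∃ u v, w = N u v} ∨ U ≤ LinearMap.ker N)
    (f : Fin l → E)
    (hf : U ⊔ Submodule.span ℝ (range f ∪ range (fun i => J (f i))) = ⊤) :
    Module.finrank ℝ (annihilatingSymbols J N k) ≤
      m.multichoose k * Module.finrank ℝ (LinearMap.ker N) +
      l.multichoose (k + 1) *
        Module.finrank ℝ (Submodule.span ℝ {w | ∃ u v, w = N u v}) := by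
  set G := annihilatingSymbols J N k with hG
  let L := (contractWith N k).domRestrict G
  have hNJ' := antilinear_right_of_left hNJ hskew
  -- A vanishing contraction means that all values of `T` lie in `ker N`.
  have hker : Module.finrank ℝ (LinearMap.ker L) ≤
      m.multichoose k * Module.finrank ℝ (LinearMap.ker N) := by
    rw [← Submodule.finrank_map_subtype_eq G (LinearMap.ker L)]
    have hle : (LinearMap.ker L).map G.subtype ≤ G := Submodule.map_subtype_le _ _
    refine finrank_le_multichoose_mul _ J J _ (LinearMap.ker N) e he ?_
      (fun T hT => (hle hT).1) (fun T hT => (hle hT).2.1)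
      (fun T hT v i x hx => map_update_eq_zero_of_mem_span (hle hT) v i hx)
    rintro _ ⟨T, hT, rfl⟩ v
    rw [LinearMap.mem_ker]
    ext y
    have h1 : contractWith N k T.1 (Fin.snoc v y) = 0 := by
      have : contractWith N k T.1 = 0 := hT
      rw [this]; rfl
    rw [contractWith_apply, Fin.init_snoc, Fin.snoc_last] at h1
    exact h1
  have hrange : Module.finrank ℝ (LinearMap.range L) ≤ l.multichoose (k + 1) *
      Module.finrank ℝ (Submodule.span ℝ {w | ∃ u v, w = N u v}) := by
    -- The contractions are antilinear in every slot, hence `-J` on the target.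
    refine finrank_le_multichoose_mul _ J (-J) U _ f hf ?_ ?_ ?_ ?_
    · rintro _ ⟨T, rfl⟩ v
      exact Submodule.subset_span ⟨_, _, rfl⟩
    · rintro _ ⟨T, rfl⟩ σ v
      exact contractWith_comp_perm T.2 σ v
    · rintro _ ⟨T, rfl⟩ v i x
      change contractWith N k T.1 _ = -J (contractWith N k T.1 _)
      induction i using Fin.lastCases with
      | last => rw [contractWith_update_last, contractWith_update_last, hNJ']
      | cast i =>
        rw [contractWith_update_castSucc, contractWith_update_castSucc, T.2.2.1, hNJ]
    · rintro _ ⟨T, rfl⟩ v i x hx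
      change contractWith N k T.1 _ = 0
      have hcast : ∀ (v : Fin k → E) (i : Fin k) (y : E),
          N (T.1 (Function.update v i x)) y = 0 := by
        intro v i y
        rcases hU with hU | hU
        · rw [map_update_eq_zero_of_mem_span T.2 v i (hU hx), map_zero]; rfl
        · rw [T.2.2.2.2, hskew, LinearMap.mem_ker.1 (hU hx)]; simp
      induction i using Fin.lastCases with
      | last =>
        rw [contractWith_update_last]
        -- The vector `x` in the last slot is exchanged with the entry of slot `0`, which exists
        -- because `0 < k`.
        have h1 := T.2.2.2.2 (Fin.init v) ⟨0, hk⟩ x (Fin.init v ⟨0, hk⟩)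
        rw [Function.update_eq_self, hcast] at h1
        exact h1.symm
      | cast i => rw [contractWith_update_castSucc, hcast]
  have := LinearMap.finrank_range_add_finrank_ker L
  omega

/-! ### Antilinear brackets with values in a complex line -/

/-- A complex structure has no real eigenvector: `s w + t J w = 0` forces `(s² + t²) w = 0`. -/
theorem eq_smul_add_smul_of_finrank_two {J : E →ₗ[ℝ] E} (hJ : ∀ v, J (J v) = -v)
    {W : Submodule ℝ E} (hW : Module.finrank ℝ W = 2) (hWJ : ∀ w ∈ W, J w ∈ W)
    {w : E} (hw : w ∈ W) (hw0 : w ≠ 0) : W = Submodule.span ℝ {w, J w} := by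
  have hli : LinearIndependent ℝ ![w, J w] := by
    rw [LinearIndependent.pair_iff]
    intro s t h
    have h2 : s • J w - t • w = 0 := by
      have := congrArg J h
      simpa [hJ, sub_eq_add_neg] using this
    have h3 : (s * s + t * t) • w = 0 := by
      have : (s * s + t * t) • w = s • (s • w + t • J w) - t • (s • J w - t • w) := by module
      rw [this, h, h2]; simp
    have h4 := (smul_eq_zero.1 h3).resolve_right hw0
    constructor <;> nlinarith [mul_self_nonneg s, mul_self_nonneg t]
  have hle : Submodule.span ℝ {w, J w} ≤ W := by
    rw [Submodule.span_le]
    rintro _ (rfl | rfl)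
    exacts [hw, hWJ _ hw]
  refine (Submodule.eq_of_le_of_finrank_eq hle ?_).symm
  have := finrank_span_eq_card hli
  rw [Matrix.range_cons_cons_empty] at this
  rw [hW, this]; rfl

variable {J : E →ₗ[ℝ] E} {N : E →ₗ[ℝ] E →ₗ[ℝ] E}

/-- A hyperbolic pair of vectors solves every linear problem posed on it. -/
theorem exists_bracket_eq (hJ : ∀ v, J (J v) = -v) (hNJ : ∀ u v, N (J u) v = -J (N u v))
    (hskew : ∀ u v, N u v = -N v u)
    (hW : Module.finrank ℝ (Submodule.span ℝ {w | ∃ u v, w = N u v}) = 2)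
    {P : Submodule ℝ E} (hP : ∀ x ∈ P, J x ∈ P) {u v : E} (hu : u ∈ P) (hv : v ∈ P)
    (huv : N u v ≠ 0) {α β : E} (hα : α ∈ Submodule.span ℝ {w | ∃ u v, w = N u v})
    (hβ : β ∈ Submodule.span ℝ {w | ∃ u v, w = N u v}) :
    ∃ s ∈ P, N s u = α ∧ N s v = β ∧ ∀ x, N x u = 0 → N x v = 0 → N x s = 0 := by
  have hWJ : ∀ w ∈ Submodule.span ℝ {w | ∃ u v, w = N u v},
      J w ∈ Submodule.span ℝ {w | ∃ u v, w = N u v} := by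
    intro w hw
    have h : Submodule.span ℝ {w | ∃ u v, w = N u v} ≤
        (Submodule.span ℝ {w | ∃ u v, w = N u v}).comap J := by
      rw [Submodule.span_le]
      rintro _ ⟨x, y, rfl⟩
      refine Submodule.subset_span ⟨-J x, y, ?_⟩
      rw [map_neg, LinearMap.neg_apply, hNJ, neg_neg]
    exact h hw
  have hNJ' := antilinear_right_of_left hNJ hskew
  have hself : ∀ x, N x x = 0 := fun x => eq_zero_of_eq_neg_self (hskew x x)
  have hspan := eq_smul_add_smul_of_finrank_two hJ hW hWJ
    (Submodule.subset_span ⟨u, v, rfl⟩) huv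
  rw [hspan, Submodule.mem_span_pair] at hα hβ
  obtain ⟨a, b, rfl⟩ := hα
  obtain ⟨c, d, rfl⟩ := hβ
  -- The signs compensate the skewness and antilinearity of `N`. Being a complex combination of `u`
  -- and `v`, this vector is orthogonal to all that is orthogonal to both.
  refine ⟨-(a • v) + b • J v + c • u - d • J u, ?_, ?_, ?_, ?_⟩
  · exact P.sub_mem (P.add_mem (P.add_mem (P.neg_mem (P.smul_mem _ hv))
      (P.smul_mem _ (hP _ hv))) (P.smul_mem _ hu)) (P.smul_mem _ (hP _ hu))
  · simp [hNJ, hself, hskew v u]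
  · simp [hNJ, hself]
  · intro x hxu hxv
    simp [hNJ', hxu, hxv]

/-- The orthogonal complement of a hyperbolic pair has real codimension four. -/
theorem finrank_orthogonal_add_four (hJ : ∀ v, J (J v) = -v)
    (hNJ : ∀ u v, N (J u) v = -J (N u v)) (hskew : ∀ u v, N u v = -N v u)
    (hW : Module.finrank ℝ (Submodule.span ℝ {w | ∃ u v, w = N u v}) = 2)
    {P : Submodule ℝ E} (hP : ∀ x ∈ P, J x ∈ P) {u v : E} (hu : u ∈ P) (hv : v ∈ P)
    (huv : N u v ≠ 0) :
    Module.finrank ℝ (P ⊓ LinearMap.ker (N.flip u) ⊓ LinearMap.ker (N.flip v) : Submodule ℝ E) + 4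
      = Module.finrank ℝ P := by
  set W := Submodule.span ℝ {w | ∃ u v, w = N u v} with hWdef
  have hmem : ∀ x y, N x y ∈ W := fun x y => Submodule.subset_span ⟨x, y, rfl⟩
  let Φ : P →ₗ[ℝ] W × W :=
    (((N.flip u).codRestrict W (fun x => hmem x u)).prod
      ((N.flip v).codRestrict W (fun x => hmem x v))).domRestrict P
  have hsurj : LinearMap.range Φ = ⊤ := by
    rw [LinearMap.range_eq_top]
    rintro ⟨⟨α, hα⟩, ⟨β, hβ⟩⟩
    obtain ⟨s, hs, h1, h2, -⟩ := exists_bracket_eq hJ hNJ hskew hW hP hu hv huv hα hβ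
    exact ⟨⟨s, hs⟩, Prod.ext (Subtype.ext h1) (Subtype.ext h2)⟩
  have hker : (LinearMap.ker Φ).map P.subtype
      = P ⊓ LinearMap.ker (N.flip u) ⊓ LinearMap.ker (N.flip v) := by
    ext x
    constructor
    · rintro ⟨⟨x, hx⟩, h, rfl⟩
      have h' : Φ ⟨x, hx⟩ = 0 := h
      exact ⟨⟨hx, congrArg (fun q : W × W => (q.1 : E)) h'⟩,
        congrArg (fun q : W × W => (q.2 : E)) h'⟩
    · rintro ⟨⟨hx, h1⟩, h2⟩
      exact ⟨⟨x, hx⟩, Prod.ext (Subtype.ext h1) (Subtype.ext h2), rfl⟩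
  rw [← hker, Submodule.finrank_map_subtype_eq]
  have h := LinearMap.finrank_range_add_finrank_ker Φ
  rw [hsurj, finrank_top, Module.finrank_prod, hW] at h
  omega

/-- A nonzero antilinear bracket with values in a complex line has complex rank two or at least
four. -/
theorem finrank_quotient_ker_eq_four_or (hJ : ∀ v, J (J v) = -v)
    (hNJ : ∀ u v, N (J u) v = -J (N u v)) (hskew : ∀ u v, N u v = -N v u)
    (hW : Module.finrank ℝ (Submodule.span ℝ {w | ∃ u v, w = N u v}) = 2)
    (hN : ∃ u v, N u v ≠ 0) :
    Module.finrank ℝ (E ⧸ LinearMap.ker N) = 4 ∨ 8 ≤ Module.finrank ℝ (E ⧸ LinearMap.ker N) := by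
  obtain ⟨u, v, huv⟩ := hN
  have h1 := finrank_orthogonal_add_four hJ hNJ hskew hW (P := ⊤) (fun _ _ => trivial)
    (Submodule.mem_top : u ∈ ⊤) (Submodule.mem_top : v ∈ ⊤) huv
  rw [finrank_top, top_inf_eq] at h1
  set P := LinearMap.ker (N.flip u) ⊓ LinearMap.ker (N.flip v) with hPdef
  have hmemP : ∀ x, x ∈ P ↔ N x u = 0 ∧ N x v = 0 := fun x => Iff.rfl
  have hZ := Submodule.finrank_quotient_add_finrank (LinearMap.ker N)
  have hZP : LinearMap.ker N ≤ P := by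
    intro x hx
    rw [hmemP, LinearMap.mem_ker.1 hx]
    exact ⟨rfl, rfl⟩
  -- If the orthogonal complement `P` of the first hyperbolic pair is null, the rank is two;
  -- otherwise `P` contains a second pair, and the codimension grows by four again.
  by_cases hPZ : P ≤ LinearMap.ker N
  · left
    rw [le_antisymm hPZ hZP] at h1
    omega
  · right
    obtain ⟨x, hxP, hxZ⟩ := Set.not_subset.1 hPZ
    obtain ⟨y, hy⟩ : ∃ y, N x y ≠ 0 := by
      by_contra! h
      exact hxZ (LinearMap.mem_ker.2 (LinearMap.ext h))
    -- Gram–Schmidt: `y - s` is the projection of `y` to `P`, and pairing it with `x ∈ P` gives the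
    -- same value as `y`.
    obtain ⟨s, -, hs1, hs2, hs⟩ := exists_bracket_eq hJ hNJ hskew hW (P := ⊤) (fun _ _ => trivial)
      (Submodule.mem_top : u ∈ ⊤) (Submodule.mem_top : v ∈ ⊤) huv
      (Submodule.subset_span ⟨y, u, rfl⟩) (Submodule.subset_span ⟨y, v, rfl⟩)
    have hx := (hmemP x).1 hxP
    have hys : y - s ∈ P := by
      rw [hmemP]
      simp [hs1, hs2]
    have hxys : N x (y - s) ≠ 0 := by
      rwa [map_sub, hs x hx.1 hx.2, sub_zero]
    have hPJ : ∀ z ∈ P, J z ∈ P := by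
      intro z hz
      rw [hmemP] at hz ⊢
      simp [hNJ, hz.1, hz.2]
    have h2 := finrank_orthogonal_add_four hJ hNJ hskew hW hPJ hxP hys hxys
    have h3 : LinearMap.ker N ≤
        P ⊓ LinearMap.ker (N.flip x) ⊓ LinearMap.ker (N.flip (y - s)) := by
      intro z hz
      have hz0 := LinearMap.mem_ker.1 hz
      exact ⟨⟨hZP hz, by simp [hz0]⟩, by simp [hz0]⟩
    have h4 := Submodule.finrank_mono h3
    omega

end Symbols

/-! ### Higher derivatives -/

section Calculus

universe u

variable {E F G H : Type u} [NormedAddCommGroup E] [NormedSpace ℝ E]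
  [NormedAddCommGroup F] [NormedSpace ℝ F] [NormedAddCommGroup G] [NormedSpace ℝ G]
  [NormedAddCommGroup H] [NormedSpace ℝ H]

theorem ContDiffAt.fderiv_infty {f : E → F} {p : E} (hf : ContDiffAt ℝ ∞ f p) :
    ContDiffAt ℝ ∞ (fderiv ℝ f) p := hf.fderiv_right (by simp)

/-- The second derivative is symmetric at all nearby points, so its germ is fixed by the flip, a
continuous linear map, which commutes with differentiation. -/
theorem iteratedFDeriv_fderiv_fderiv_comm {f : E → F} {p : E} (hf : ContDiffAt ℝ ∞ f p) {k : ℕ}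
    (w : Fin k → E) (a b : E) :
    iteratedFDeriv ℝ k (fderiv ℝ (fderiv ℝ f)) p w a b
      = iteratedFDeriv ℝ k (fderiv ℝ (fderiv ℝ f)) p w b a := by
  let L : (E →L[ℝ] E →L[ℝ] F) →L[ℝ] (E →L[ℝ] E →L[ℝ] F) :=
    (ContinuousLinearMap.flipₗᵢ ℝ E E F).toContinuousLinearEquiv.toContinuousLinearMap
  have hsymm : (fderiv ℝ (fderiv ℝ f)) =ᶠ[𝓝 p] L ∘ fderiv ℝ (fderiv ℝ f) := by
    have h2 : ContDiffAt ℝ (2 : ℕ) f p := contDiffAt_infty.1 hf 2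
    filter_upwards [h2.eventually (by simp)] with q hq
    ext a b
    exact hq.isSymmSndFDerivAt (by simp) a b
  have h4 := (hsymm.iteratedFDeriv ℝ k).eq_of_nhds
  have h5 := ContinuousLinearMap.iteratedFDeriv_comp_left (F := E →L[ℝ] E →L[ℝ] F)
    (G := E →L[ℝ] E →L[ℝ] F) L hf.fderiv_infty.fderiv_infty (i := k)
    (by exact_mod_cast le_top)
  have h6 := h4.trans h5
  conv_lhs => rw [h6]
  rfl

/-- The iterated derivatives of a smooth function are symmetric. -/
theorem iteratedFDeriv_comp_perm_of_smooth {f : E → F} {p : E} (hf : ContDiffAt ℝ ∞ f p) {m : ℕ}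
    (σ : Equiv.Perm (Fin m)) (v : Fin m → E) :
    iteratedFDeriv ℝ m f p (v ∘ σ) = iteratedFDeriv ℝ m f p v := by
  induction m generalizing F with
  | zero => congr 1; exact Subsingleton.elim _ _
  | succ k ih =>
    refine comp_perm_of_comp_adjacent_swap (f := fun v => iteratedFDeriv ℝ (k + 1) f p v)
      (fun v i => ?_) σ v
    obtain _ | k := k
    · exact i.elim0
    induction i using Fin.lastCases with
    | last =>
      simp only [iteratedFDeriv_succ_apply_right]
      have h7 : Fin.init (Fin.init (v ∘ Equiv.swap (Fin.last k).castSucc (Fin.last k).succ))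
          = Fin.init (Fin.init v) := by
        funext j
        simp only [Fin.init, Function.comp]
        rw [Equiv.swap_apply_of_ne_of_ne]
        · simp
        · exact (Fin.castSucc_lt_last _).ne
      rw [h7, iteratedFDeriv_fderiv_fderiv_comm hf]
      congr 1
      · congr 1
        simp [Fin.init]
      · simp [Fin.init]
    | cast i =>
      rw [iteratedFDeriv_succ_apply_right (n := k + 1), iteratedFDeriv_succ_apply_right (n := k + 1)]
      have h1 : Fin.init (v ∘ Equiv.swap i.castSucc.castSucc i.castSucc.succ)
          = Fin.init v ∘ Equiv.swap i.castSucc i.succ := by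
        funext j
        simp only [Fin.init, Function.comp]
        rw [← (Fin.castSucc_injective _).swap_apply]
        rfl
      rw [h1, ih hf.fderiv_infty]
      congr 1
      simp only [Function.comp]
      rw [Equiv.swap_apply_of_ne_of_ne (Fin.castSucc_lt_last _).ne']
      exact (Fin.castSucc_lt_last i.succ).ne'

theorem iteratedFDeriv_fderiv_apply {f : E → F} {p : E} {m : ℕ} (v : Fin m → E) (x : E) :
    iteratedFDeriv ℝ m (fderiv ℝ f) p v x
      = iteratedFDeriv ℝ (m + 1) f p (Fin.snoc (α := fun _ => E) v x) := by
  rw [iteratedFDeriv_succ_apply_right, Fin.init_snoc, Fin.snoc_last]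

theorem iteratedFDeriv_fderiv_eq_zero {f : E → F} {p : E} {m : ℕ}
    (h : ∀ j < m + 1, iteratedFDeriv ℝ j f p = 0) :
    ∀ j < m, iteratedFDeriv ℝ j (fderiv ℝ f) p = 0 := by
  intro j hj
  ext v x
  rw [iteratedFDeriv_fderiv_apply, h (j + 1) (by omega)]
  rfl

theorem fderiv_bilinear_eventuallyEq (B : F →L[ℝ] G →L[ℝ] H) {f : E → F} {g : E → G} {p : E}
    (hf : ContDiffAt ℝ ∞ f p) (hg : ContDiffAt ℝ ∞ g p) :
    fderiv ℝ (fun q => B (f q) (g q)) =ᶠ[𝓝 p]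
      fun q => B.precompR E (f q) (fderiv ℝ g q) + B.precompL E (fderiv ℝ f q) (g q) := by
  have hf1 : ContDiffAt ℝ 1 f p := hf.of_le (by exact_mod_cast le_top)
  have hg1 : ContDiffAt ℝ 1 g p := hg.of_le (by exact_mod_cast le_top)
  filter_upwards [hf1.eventually (by simp), hg1.eventually (by simp)] with q hfq hgq
  exact B.fderiv_of_bilinear (hfq.differentiableAt (by simp)) (hgq.differentiableAt (by simp))

theorem ContDiffAt.bilinear (B : F →L[ℝ] G →L[ℝ] H) {f : E → F} {g : E → G} {p : E}
    (hf : ContDiffAt ℝ ∞ f p) (hg : ContDiffAt ℝ ∞ g p) :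
    ContDiffAt ℝ ∞ (fun q => B (f q) (g q)) p :=
  (B.contDiff.contDiffAt.comp p hf).clm_apply hg

theorem iteratedFDeriv_succ_bilinear_apply (B : F →L[ℝ] G →L[ℝ] H) {f : E → F} {g : E → G} {p : E}
    (hf : ContDiffAt ℝ ∞ f p) (hg : ContDiffAt ℝ ∞ g p) {m : ℕ} (ζ : Fin (m + 1) → E) :
    iteratedFDeriv ℝ (m + 1) (fun q => B (f q) (g q)) p ζ =
      iteratedFDeriv ℝ m (fun q => B.precompR E (f q) (fderiv ℝ g q)) p (Fin.init ζ)
        (ζ (Fin.last m)) +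
      iteratedFDeriv ℝ m (fun q => B.precompL E (fderiv ℝ f q) (g q)) p (Fin.init ζ)
        (ζ (Fin.last m)) := by
  rw [iteratedFDeriv_succ_apply_right,
    ((fderiv_bilinear_eventuallyEq B hf hg).iteratedFDeriv ℝ m).eq_of_nhds,
    fun_iteratedFDeriv_add_apply]
  · rfl
  · exact ((hf.bilinear _ hg.fderiv_infty)).of_le (by exact_mod_cast le_top)
  · exact ((hf.fderiv_infty.bilinear _ hg)).of_le (by exact_mod_cast le_top)

/-- The leading derivative of a product one of whose factors has vanishing jets. -/
theorem iteratedFDeriv_bilinear_of_jet_eq_zero (B : F →L[ℝ] G →L[ℝ] H) {f : E → F} {g : E → G}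
    {p : E} (hf : ContDiffAt ℝ ∞ f p) (hg : ContDiffAt ℝ ∞ g p) {m : ℕ}
    (h : ∀ j < m, iteratedFDeriv ℝ j f p = 0) (ζ : Fin m → E) :
    iteratedFDeriv ℝ m (fun q => B (f q) (g q)) p ζ = B (iteratedFDeriv ℝ m f p ζ) (g p) := by
  -- The derivative of a bilinear product is a sum of two bilinear products with other factors and
  -- other target spaces, so these must vary in the induction.
  induction m generalizing F G H with
  | zero => simp
  | succ m ih =>
    rw [iteratedFDeriv_succ_bilinear_apply B hf hg,
      ih _ hf hg.fderiv_infty (fun j hj => h j (by omega)),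
      ih _ hf.fderiv_infty hg (iteratedFDeriv_fderiv_eq_zero h), h m (by omega),
      iteratedFDeriv_succ_apply_right]
    simp

/-- The subleading derivative of a product one of whose factors has vanishing jets. -/
theorem iteratedFDeriv_succ_bilinear_of_jet_eq_zero (B : F →L[ℝ] G →L[ℝ] H) {f : E → F} {g : E → G}
    {p : E} (hf : ContDiffAt ℝ ∞ f p) (hg : ContDiffAt ℝ ∞ g p) {m : ℕ}
    (h : ∀ j < m, iteratedFDeriv ℝ j f p = 0) (ζ : Fin (m + 1) → E) :
    iteratedFDeriv ℝ (m + 1) (fun q => B (f q) (g q)) p ζ =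
      B (iteratedFDeriv ℝ (m + 1) f p ζ) (g p) +
        ∑ i, B (iteratedFDeriv ℝ m f p (ζ ∘ i.succAbove)) (fderiv ℝ g p (ζ i)) := by
  induction m generalizing F G H with
  | zero =>
    rw [iteratedFDeriv_succ_bilinear_apply B hf hg]
    simp [add_comm]
  | succ m ih =>
    rw [iteratedFDeriv_succ_bilinear_apply B hf hg,
      iteratedFDeriv_bilinear_of_jet_eq_zero _ hf hg.fderiv_infty h,
      ih _ hf.fderiv_infty hg (iteratedFDeriv_fderiv_eq_zero h), Fin.sum_univ_castSucc (n := m + 1),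
      iteratedFDeriv_succ_apply_right (n := m + 1)]
    have h1 : ∀ i : Fin (m + 1),
        iteratedFDeriv ℝ (m + 1) f p (ζ ∘ i.castSucc.succAbove) =
          iteratedFDeriv ℝ m (fderiv ℝ f) p (Fin.init ζ ∘ i.succAbove) (ζ (Fin.last (m + 1))) := by
      intro i
      rw [iteratedFDeriv_succ_apply_right]
      congr 1
      · congr 1
        funext j
        simp [Fin.init, Fin.castSucc_succAbove_castSucc]
      · simp only [Function.comp]
        rw [Fin.succAbove_of_le_castSucc _ _ (Fin.castSucc_le_castSucc_iff.2 (Fin.le_last i)),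
          Fin.succ_last]
    have h2 : ζ ∘ (Fin.last (m + 1)).succAbove = Fin.init ζ := by
      funext j; simp [Fin.init]
    rw [h2]
    simp only [h1]
    simp [Fin.init]
    abel

end Calculus

/-! ### Jets of infinitesimal symmetries -/

section Jets

/-- The hypothesis `h` is the second jet equation with all but two directions frozen; `Q` holds the
unknown derivatives of the next order. The combination of `h (J v) u`, `J (h u v)`, `-h (J u) v` and
`-J (h v u)` is the one that forms the Nijenhuis bracket from `K = dJ`. In it `Q` cancels by
symmetry, and the terms with `k i` cancel because `C i` is symmetric and complex bilinear. -/
theorem bracket_derivation_of_equations {ι E : Type*} [AddCommGroup E] [Module ℝ E] [Fintype ι]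
    (J : E →ₗ[ℝ] E) (K : E →ₗ[ℝ] E →ₗ[ℝ] E) (B : E →ₗ[ℝ] E) (Q : E → E → E)
    (k : ι → E →ₗ[ℝ] E) (C : ι → E → E → E)
    (hB : ∀ x, B (J x) = J (B x)) (hQ : ∀ x y, Q x y = Q y x)
    (hC : ∀ i x y, C i x y = C i y x) (hCJ : ∀ i x y, C i x (J y) = J (C i x y))
    (h : ∀ a b, K (B a) b - (Q a (J b) + (∑ i, C i a (k i b) + B (K a b)))
      + (J (Q a b) + (∑ i, k i (C i a b) + K a (B b))) = 0) (u v : E) :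
    B (K (J u) v - K (J v) u - J (K u v) + J (K v u)) =
      (K (J (B u)) v - K (J v) (B u) - J (K (B u) v) + J (K v (B u))) +
      (K (J u) (B v) - K (J (B v)) u - J (K u (B v)) + J (K (B v) u)) := by
  have hCJ' : ∀ i x y, C i (J x) y = J (C i x y) := fun i x y => by rw [hC, hCJ, hC]
  have s1 : ∑ i, C i (J u) (k i v) = J (∑ i, C i u (k i v)) := by
    rw [map_sum]; exact Finset.sum_congr rfl fun i _ => hCJ' i _ _
  have s2 : ∑ i, C i (J v) (k i u) = J (∑ i, C i v (k i u)) := by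
    rw [map_sum]; exact Finset.sum_congr rfl fun i _ => hCJ' i _ _
  have s3 : ∑ i, k i (C i (J v) u) = ∑ i, k i (C i (J u) v) :=
    Finset.sum_congr rfl fun i _ => by rw [hCJ', hCJ', hC]
  have s4 : ∑ i, k i (C i v u) = ∑ i, k i (C i u v) :=
    Finset.sum_congr rfl fun i _ => by rw [hC]
  have h1 := h (J u) v
  have h2 := h (J v) u
  have h3 := congrArg J (h u v)
  have h4 := congrArg J (h v u)
  rw [s1, hB, hQ (J u) v] at h1
  rw [s2, s3, hB, hQ (J v) (J u), hQ (J v) u] at h2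
  rw [s4, hQ v u] at h4
  simp only [map_add, map_sub, map_zero, hB] at h1 h2 h3 h4 ⊢
  have e : _ + _ - (_ + _) = (0 : E) + 0 - (0 + 0) :=
    congrArg₂ (· - ·) (congrArg₂ (· + ·) h2 h3) (congrArg₂ (· + ·) h1 h4)
  rw [← sub_eq_zero]
  refine Eq.trans ?_ (e.trans (by simp))
  abel

variable {E : Type*} [NormedAddCommGroup E] [NormedSpace ℝ E]

/-- The Nijenhuis bracket in terms of the value and the derivative of the structure. -/
noncomputable def nijenhuisBilin (A : E →L[ℝ] E) (K : E →L[ℝ] E →L[ℝ] E) : E →ₗ[ℝ] E →ₗ[ℝ] E :=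
  LinearMap.mk₂ ℝ (fun u v => K (A u) v - K (A v) u - A (K u v) + A (K v u))
    (fun _ _ _ => by simp; abel) (fun _ _ _ => by simp [smul_sub])
    (fun _ _ _ => by simp; abel) (fun _ _ _ => by simp [smul_sub])

theorem nijenhuisBilin_apply (A : E →L[ℝ] E) (K : E →L[ℝ] E →L[ℝ] E) (u v : E) :
    nijenhuisBilin A K u v = K (A u) v - K (A v) u - A (K u v) + A (K v u) := rfl

theorem nijenhuisBilin_skew (A : E →L[ℝ] E) (K : E →L[ℝ] E →L[ℝ] E) (u v : E) :
    nijenhuisBilin A K u v = -nijenhuisBilin A K v u := by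
  simp only [nijenhuisBilin_apply]; abel

theorem nijenhuisBilin_antilinear {A : E →L[ℝ] E} {K : E →L[ℝ] E →L[ℝ] E}
    (hA : ∀ v, A (A v) = -v) (hK : ∀ a v, K a (A v) = -A (K a v)) (u v : E) :
    nijenhuisBilin A K (A u) v = -A (nijenhuisBilin A K u v) := by
  simp only [nijenhuisBilin_apply, hA, hK, map_neg, map_add, map_sub]
  simp; abel

theorem fderiv_apply_const {J : E → E →L[ℝ] E} {q : E} (hJ : DifferentiableAt ℝ J q) (v w : E) :
    fderiv ℝ (fun x => J x v) q w = fderiv ℝ J q w v := by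
  rw [fderiv_clm_apply hJ (differentiableAt_const v)]
  simp

theorem nijenhuisAt_eq {J : E → E →L[ℝ] E} {p : E} (hJ : DifferentiableAt ℝ J p) (u v : E) :
    nijenhuisAt J p u v = nijenhuisBilin (J p) (fderiv ℝ J p) u v := by
  simp [nijenhuisAt, nijenhuis, VectorField.lieBracket, fderiv_apply_const hJ,
    nijenhuisBilin_apply]

/-- The derivative of an almost complex structure anticommutes with it. -/
theorem fderiv_anticomm {J : E → E →L[ℝ] E} {p : E} (hJ : DifferentiableAt ℝ J p)
    (hJ2 : ∀ᶠ q in 𝓝 p, ∀ v, J q (J q v) = -v) (a v : E) :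
    fderiv ℝ J p a (J p v) = -J p (fderiv ℝ J p a v) := by
  have h1 : (fun q => J q (J q v)) =ᶠ[𝓝 p] fun _ => -v := hJ2.mono fun q hq => hq v
  have h2 := h1.fderiv_eq (𝕜 := ℝ)
  have hJv : DifferentiableAt ℝ (fun q => J q v) p := hJ.clm_apply (differentiableAt_const v)
  rw [fderiv_clm_apply hJ hJv] at h2
  have h3 := DFunLike.congr_fun h2 a
  simp [fderiv_apply_const hJ] at h3
  rw [eq_neg_iff_add_eq_zero, add_comm]
  exact h3

/-- The Lie derivative of `J` as a field of endomorphisms. -/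
theorem lieDerivEndo_eventuallyEq {J : E → E →L[ℝ] E} {p : E} (hJ : ContDiffAt ℝ ∞ J p)
    (X : E → E) (v : E) :
    lieDerivEndo J X v =ᶠ[𝓝 p] fun q => ContinuousLinearMap.apply ℝ E v
      (fderiv ℝ J q (X q) - (fderiv ℝ X q).comp (J q) + (J q).comp (fderiv ℝ X q)) := by
  have h1 : ContDiffAt ℝ (1 : ℕ) J p := contDiffAt_infty.1 hJ 1
  filter_upwards [h1.eventually (by simp)] with q hq
  simp [lieDerivEndo, VectorField.lieBracket,
    fderiv_apply_const (hq.differentiableAt (by simp))]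

/-- The jets of the Lie derivative of `J` along a field with vanishing lower jets. -/
theorem jet_equations_of_mem_formalSymmetries {J : E → E →L[ℝ] E} {p : E}
    (hJ : ContDiffAt ℝ ∞ J p) {X : E → E} (hX : X ∈ formalSymmetries J p) {m : ℕ}
    (h0 : ∀ j < m + 1, iteratedFDeriv ℝ j X p = 0) :
    (∀ (ζ : Fin m → E) (v : E), iteratedFDeriv ℝ m (fderiv ℝ X) p ζ (J p v)
      = J p (iteratedFDeriv ℝ m (fderiv ℝ X) p ζ v)) ∧
    ∀ (ζ : Fin (m + 1) → E) (v : E),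
      fderiv ℝ J p (iteratedFDeriv ℝ (m + 1) X p ζ) v
      - (iteratedFDeriv ℝ (m + 1) (fderiv ℝ X) p ζ (J p v)
        + ∑ i, iteratedFDeriv ℝ m (fderiv ℝ X) p (ζ ∘ i.succAbove) (fderiv ℝ J p (ζ i) v))
      + (J p (iteratedFDeriv ℝ (m + 1) (fderiv ℝ X) p ζ v)
        + ∑ i, fderiv ℝ J p (ζ i) (iteratedFDeriv ℝ m (fderiv ℝ X) p (ζ ∘ i.succAbove) v)) = 0 := by
  obtain ⟨hXs, hL⟩ := hX
  let B₁ : E →L[ℝ] (E →L[ℝ] E →L[ℝ] E) →L[ℝ] (E →L[ℝ] E) :=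
    ContinuousLinearMap.apply ℝ (E →L[ℝ] E)
  let B₂ : (E →L[ℝ] E) →L[ℝ] (E →L[ℝ] E) →L[ℝ] (E →L[ℝ] E) := ContinuousLinearMap.compL ℝ E E E
  let B₃ : (E →L[ℝ] E) →L[ℝ] (E →L[ℝ] E) →L[ℝ] (E →L[ℝ] E) :=
    (ContinuousLinearMap.compL ℝ E E E).flip
  have hX' := hXs.fderiv_infty
  have hJ' := hJ.fderiv_infty
  have hX0 := iteratedFDeriv_fderiv_eq_zero h0
  have c₁ : ContDiffAt ℝ ∞ (fun q => B₁ (X q) (fderiv ℝ J q)) p := hXs.bilinear B₁ hJ'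
  have c₂ : ContDiffAt ℝ ∞ (fun q => B₂ (fderiv ℝ X q) (J q)) p := hX'.bilinear B₂ hJ
  have c₃ : ContDiffAt ℝ ∞ (fun q => B₃ (fderiv ℝ X q) (J q)) p := hX'.bilinear B₃ hJ
  have key : ∀ (l : ℕ) (ζ : Fin l → E) (v : E),
      iteratedFDeriv ℝ l (fun q => B₁ (X q) (fderiv ℝ J q)) p ζ v
      - iteratedFDeriv ℝ l (fun q => B₂ (fderiv ℝ X q) (J q)) p ζ v
      + iteratedFDeriv ℝ l (fun q => B₃ (fderiv ℝ X q) (J q)) p ζ v = 0 := by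
    intro l ζ v
    have hl : ((l : ℕ) : WithTop ℕ∞) ≤ ∞ := by exact_mod_cast le_top
    have h1 := hL v l
    have h2 := ((lieDerivEndo_eventuallyEq hJ X v).iteratedFDeriv ℝ l).eq_of_nhds
    have h3 := ContinuousLinearMap.iteratedFDeriv_comp_left
      (ContinuousLinearMap.apply ℝ E v) ((c₁.sub c₂).add c₃) (i := l) hl
    have h4 := (h2.symm.trans h1).symm.trans h3
    have h5 := congrArg (fun T => T ζ) h4
    rw [fun_iteratedFDeriv_add_apply ((c₁.sub c₂).of_le hl) (c₃.of_le hl),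
      fun_iteratedFDeriv_sub_apply (c₁.of_le hl) (c₂.of_le hl)] at h5
    exact h5.symm
  constructor
  · intro ζ v
    have h := key m ζ v
    rw [iteratedFDeriv_bilinear_of_jet_eq_zero B₁ hXs hJ' (fun j hj => h0 j (by omega)),
      iteratedFDeriv_bilinear_of_jet_eq_zero B₂ hX' hJ hX0,
      iteratedFDeriv_bilinear_of_jet_eq_zero B₃ hX' hJ hX0, h0 m (by omega)] at h
    simp [B₁, B₂, B₃] at h
    exact (neg_add_eq_zero.1 h)
  · intro ζ v
    have h := key (m + 1) ζ v
    rw [iteratedFDeriv_bilinear_of_jet_eq_zero B₁ hXs hJ' h0,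
      iteratedFDeriv_succ_bilinear_of_jet_eq_zero B₂ hX' hJ hX0,
      iteratedFDeriv_succ_bilinear_of_jet_eq_zero B₃ hX' hJ hX0] at h
    simpa [B₁, B₂, B₃] using h

/-- The leading Taylor terms of infinitesimal symmetries. -/
theorem iteratedFDeriv_mem_annihilatingSymbols {J : E → E →L[ℝ] E} {p : E}
    (hJ : ContDiffAt ℝ ∞ J p) (hJ2 : ∀ᶠ q in 𝓝 p, ∀ v, J q (J q v) = -v)
    {X : E → E} (hX : X ∈ formalSymmetries J p) {k : ℕ} (hk : 2 ≤ k)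
    (h0 : ∀ j < k, iteratedFDeriv ℝ j X p = 0) :
    (iteratedFDeriv ℝ k X p).toMultilinearMap ∈ annihilatingSymbols (J p : E →ₗ[ℝ] E)
      (nijenhuisBilin (J p) (fderiv ℝ J p)) k := by
  obtain ⟨m, rfl⟩ : ∃ m, k = m + 1 + 1 := ⟨k - 2, by omega⟩
  have hXs := hX.1
  have hJd : DifferentiableAt ℝ J p := hJ.differentiableAt (by simp)
  have hJp := hJ2.self_of_nhds
  have hsymm := fun σ v => iteratedFDeriv_comp_perm_of_smooth hXs (m := m + 1 + 1) σ v
  obtain ⟨e1, e2⟩ := jet_equations_of_mem_formalSymmetries hJ hX h0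
  -- By symmetry the distinguished slot can be moved to the last place, where the jet equations
  -- apply.
  have hslot : ∀ (v : Fin (m + 1 + 1) → E) (i x),
      iteratedFDeriv ℝ (m + 1 + 1) X p (Function.update v i x) =
        iteratedFDeriv ℝ (m + 1) (fderiv ℝ X) p
          (Fin.init (v ∘ Equiv.swap i (Fin.last (m + 1)))) x := by
    intro v i x
    rw [iteratedFDeriv_fderiv_apply, ← hsymm (Equiv.swap i (Fin.last (m + 1)))]
    congr 1
    funext j
    induction j using Fin.lastCases with
    | last => simp
    | cast j =>
      rw [Fin.snoc_castSucc]
      simp only [Fin.init, Function.comp]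
      rw [Function.update_of_ne]
      intro h
      have := congrArg (Equiv.swap i (Fin.last (m + 1))) h
      rw [Equiv.swap_apply_self, Equiv.swap_apply_left] at this
      exact (Fin.castSucc_lt_last j).ne this
  refine mem_annihilatingSymbols_of_derivation (fun v => hJp v)
    (nijenhuisBilin_antilinear hJp (fderiv_anticomm hJd hJ2)) (nijenhuisBilin_skew _ _) hk hsymm
    (fun v i x => ?_) (fun v i x y => ?_)
  · change iteratedFDeriv ℝ (m + 1 + 1) X p _ = J p (iteratedFDeriv ℝ (m + 1 + 1) X p _)
    rw [hslot, hslot]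
    exact e1 _ _
  · change iteratedFDeriv ℝ (m + 1 + 1) X p _ =
      nijenhuisBilin _ _ (iteratedFDeriv ℝ (m + 1 + 1) X p _) _ +
      nijenhuisBilin _ _ _ (iteratedFDeriv ℝ (m + 1 + 1) X p _)
    rw [hslot, hslot, hslot]
    set η : Fin (m + 1) → E := Fin.init (v ∘ Equiv.swap i (Fin.last (m + 1)))
    have hη : ∀ (a : E) (j : Fin (m + 1)),
        (Fin.snoc (α := fun _ => E) η a : Fin (m + 1 + 1) → E) ∘ j.castSucc.succAbove
          = Fin.snoc (α := fun _ => E) (η ∘ j.succAbove) a := by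
      intro a j
      funext l
      induction l using Fin.lastCases with
      | last =>
        simp only [Function.comp, Fin.snoc_last]
        rw [Fin.succAbove_of_le_castSucc _ _ (Fin.castSucc_le_castSucc_iff.2 (Fin.le_last j)),
          Fin.succ_last, Fin.snoc_last]
      | cast l => simp [Fin.castSucc_succAbove_castSucc]
    have hlast : ∀ a : E, (Fin.snoc (α := fun _ => E) η a : Fin (m + 1 + 1) → E) ∘
        (Fin.last (m + 1)).succAbove = η := by
      intro a; funext l; simp
    refine bracket_derivation_of_equations (J p : E →ₗ[ℝ] E)
      ((ContinuousLinearMap.coeLM ℝ).comp (fderiv ℝ J p : E →ₗ[ℝ] E →L[ℝ] E))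
      (iteratedFDeriv ℝ (m + 1) (fderiv ℝ X) p η : E →ₗ[ℝ] E)
      (fun a b => iteratedFDeriv ℝ (m + 1 + 1) (fderiv ℝ X) p (Fin.snoc (α := fun _ => E) η a) b)
      (fun j => (fderiv ℝ J p (η j) : E →ₗ[ℝ] E))
      (fun j a b => iteratedFDeriv ℝ (m + 1) (fderiv ℝ X) p
        (Fin.snoc (α := fun _ => E) (η ∘ j.succAbove) a) b)
      (fun _ => e1 _ _) ?_ ?_ (fun _ _ _ => e1 _ _) (fun a b => ?_) x y
    · intro a b
      rw [← iteratedFDeriv_fderiv_apply, ← iteratedFDeriv_fderiv_apply,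
        iteratedFDeriv_fderiv_fderiv_comm hXs]
    · intro j a b
      rw [← iteratedFDeriv_fderiv_apply, ← iteratedFDeriv_fderiv_apply,
        iteratedFDeriv_fderiv_fderiv_comm hXs]
    · have h := e2 (Fin.snoc (α := fun _ => E) η a) b
      rw [Fin.sum_univ_castSucc (n := m + 1), Fin.sum_univ_castSucc (n := m + 1)] at h
      simp only [hη, hlast, Fin.snoc_last, Fin.snoc_castSucc] at h
      rw [← iteratedFDeriv_fderiv_apply (f := X)] at h
      exact h

theorem finrank_symbolSpace_le [FiniteDimensional ℝ E] {J : E → E →L[ℝ] E} {p : E}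
    (hJ : ContDiffAt ℝ ∞ J p) (hJ2 : ∀ᶠ q in 𝓝 p, ∀ v, J q (J q v) = -v)
    {S : Set (E → E)} (hS : S ⊆ formalSymmetries J p) {k : ℕ} (hk : 2 ≤ k) :
    Module.finrank ℝ (symbolSpace S p k) ≤ Module.finrank ℝ (annihilatingSymbols
      (J p : E →ₗ[ℝ] E) (nijenhuisBilin (J p) (fderiv ℝ J p)) k) := by
  let φ : ContinuousMultilinearMap ℝ (fun _ : Fin k => E) E →ₗ[ℝ]
      MultilinearMap ℝ (fun _ : Fin k => E) E := ContinuousMultilinearMap.toMultilinearMapLinear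
  have hφ : Function.Injective φ := ContinuousMultilinearMap.toMultilinearMap_injective
  have h1 : symbolSpace S p k ≤ (annihilatingSymbols (J p : E →ₗ[ℝ] E)
      (nijenhuisBilin (J p) (fderiv ℝ J p)) k).comap φ := by
    rw [symbolSpace, Submodule.span_le]
    rintro _ ⟨X, hX, h0, rfl⟩
    exact iteratedFDeriv_mem_annihilatingSymbols hJ hJ2 (hS hX) hk h0
  rw [(Submodule.equivMapOfInjective φ hφ _).finrank_eq]
  exact Submodule.finrank_mono (Submodule.map_le_iff_le_comap.2 h1)

/-- Both kinds of symmetries are thus covered by an estimate for subsets of the formal ones. -/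
theorem localSymmetries_subset_formalSymmetries (J : E → E →L[ℝ] E) (p : E) :
    localSymmetries J p ⊆ formalSymmetries J p := by
  rintro X ⟨h1, h2⟩
  refine ⟨h1.self_of_nhds, fun v m => ?_⟩
  have h : lieDerivEndo J X v =ᶠ[𝓝 p] fun _ => (0 : E) := h2.mono fun q hq => hq v
  rw [(h.iteratedFDeriv ℝ m).eq_of_nhds, iteratedFDeriv_fun_zero]
  rfl

end Jets

/-! ### The coordinate expression of an almost complex structure -/

section Chart

variable {E : Type*} [NormedAddCommGroup E] [NormedSpace ℝ E]
  {M : Type*} [TopologicalSpace M] [ChartedSpace E M] [IsManifold 𝓘(ℝ, E) ∞ M]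

/-- On the chart domain, the trivialization of the endomorphism bundle at `x` is conjugation by the
derivative of the chart, so smoothness of the section is smoothness of this expression. -/
theorem AlmostComplexStructure.contDiffAt_inChart (J : AlmostComplexStructure E M) (x : M) :
    ContDiffAt ℝ ∞ (J.inChart x) (extChartAt 𝓘(ℝ, E) x x) := by
  have h1 := ((contMDiffAt_hom_bundle _).1 (J.smooth x)).2
  have htgt : (extChartAt 𝓘(ℝ, E) x).target ∈ 𝓝 (extChartAt 𝓘(ℝ, E) x x) :=
    extChartAt_target_mem_nhds x
  have h2 : ContMDiffAt 𝓘(ℝ, E) 𝓘(ℝ, E) ∞ (extChartAt 𝓘(ℝ, E) x).symm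
      (extChartAt 𝓘(ℝ, E) x x) := (contMDiffOn_extChartAt_symm x).contMDiffAt htgt
  have h3 := (ContMDiffAt.comp_of_eq h1 h2 (extChartAt_to_inv x)).contDiffAt
  refine h3.congr_of_eventuallyEq ?_
  filter_upwards [htgt] with q hq
  have hs : (extChartAt 𝓘(ℝ, E) x).symm q ∈ (chartAt E x).source := by
    rw [← extChartAt_source 𝓘(ℝ, E)]
    exact (extChartAt 𝓘(ℝ, E) x).map_target hq
  have hI : IsManifold 𝓘(ℝ, E) 1 M := IsManifold.of_le (n := ∞) (by exact_mod_cast le_top)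
  have t1 := TangentBundle.continuousLinearMapAt_trivializationAt (I := 𝓘(ℝ, E)) hs
  have t2 := TangentBundle.symmL_trivializationAt (I := 𝓘(ℝ, E)) hs
  rw [(extChartAt 𝓘(ℝ, E) x).right_inv hq] at t2
  simp only [Function.comp, ContinuousLinearMap.inCoordinates]
  rw [t1, t2]
  simp only [modelWithCornersSelf_coe, range_id, mfderivWithin_univ]
  rfl

theorem AlmostComplexStructure.inChart_sq (J : AlmostComplexStructure E M) (x : M) :
    ∀ᶠ q in 𝓝 (extChartAt 𝓘(ℝ, E) x x), ∀ v, J.inChart x q (J.inChart x q v) = -v := by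
  have hI : IsManifold 𝓘(ℝ, E) 1 M := IsManifold.of_le (n := ∞) (by exact_mod_cast le_top)
  filter_upwards [extChartAt_target_mem_nhds (I := 𝓘(ℝ, E)) x] with q hq v
  have h1 := mfderiv_extChartAt_comp_mfderivWithin_extChartAt_symm (I := 𝓘(ℝ, E)) hq
  have h2 := mfderivWithin_extChartAt_symm_comp_mfderiv_extChartAt (I := 𝓘(ℝ, E)) hq
  simp only [modelWithCornersSelf_coe, range_id, mfderivWithin_univ] at h1 h2
  set y := (extChartAt 𝓘(ℝ, E) x).symm q
  let a : TangentSpace 𝓘(ℝ, E) y →L[ℝ] E := mfderiv 𝓘(ℝ, E) 𝓘(ℝ, E) (extChartAt 𝓘(ℝ, E) x) y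
  let b : E →L[ℝ] TangentSpace 𝓘(ℝ, E) y := mfderiv 𝓘(ℝ, E) 𝓘(ℝ, E) (extChartAt 𝓘(ℝ, E) x).symm q
  have h1' : ∀ v, a (b v) = v := fun v => DFunLike.congr_fun h1 v
  have h2' : ∀ v, b (a v) = v := fun v => DFunLike.congr_fun h2 v
  change a (J.endo y (b (a (J.endo y (b v))))) = -v
  rw [h2', J.sq_eq_neg, map_neg, h1']

end Chart

/-! ### Counting -/

section Counting

theorem DependsOnAtMost.mono {H : ℕ → ℕ} {q q' p : ℕ} (hq : q ≤ q') (h : DependsOnAtMost H q p) :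
    DependsOnAtMost H q' p := by
  obtain ⟨c, hc⟩ := h
  exact ⟨c, fun k => (hc k).trans (by gcongr)⟩

/-- A bound by finitely many functions of fewer arguments, up to a constant. -/
theorem dependsOnAtMost_of_le {H : ℕ → ℕ} {q p j C c : ℕ} (hj : j < p)
    (h : ∀ k, H k ≤ C + 2 * (q * (k + p).choose p + c * (k + j).choose j)) :
    DependsOnAtMost H q p := by
  -- The constant `C` is counted as functions of `0` arguments; if `j = 0` the two contributions add
  -- up.
  refine ⟨fun i => (if i = ⟨j, hj⟩ then c else 0) + if i = ⟨0, by omega⟩ then C else 0,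
    fun k => (h k).trans ?_⟩
  have h1 : ∑ i : Fin p, ((if i = ⟨j, hj⟩ then c else 0) + if i = ⟨0, by omega⟩ then C else 0) *
      (k + (i : ℕ)).choose (i : ℕ) = c * (k + j).choose j + C := by
    simp [add_mul, Finset.sum_add_distrib]
  rw [h1]
  omega

/-- The symbols of orders `0` and `1` escape the algebraic estimate and enter only as a constant. -/
theorem sum_range_succ_le_of_le {g b : ℕ → ℕ} (h : ∀ i, 2 ≤ i → g i ≤ b i) (k : ℕ) :
    ∑ i ∈ Finset.range (k + 1), g i ≤ g 0 + g 1 + ∑ i ∈ Finset.range (k + 1), b i := by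
  induction k with
  | zero => simp; omega
  | succ k ih =>
    rw [Finset.sum_range_succ _ (k + 1), Finset.sum_range_succ _ (k + 1)]
    rcases Nat.eq_zero_or_pos k with rfl | hk
    · simp
    · have := h (k + 1) (by omega)
      omega

theorem sum_multichoose_succ_le (l k : ℕ) :
    ∑ i ∈ Finset.range (k + 1), l.multichoose (i + 1) ≤ (k + 1 + l).choose l := by
  rw [← Nat.sum_range_multichoose (k + 1) l, Finset.sum_range_succ' _ (k + 1)]
  omega

/-- The ratio of the two binomials is `(k + 1 + l) / (k + 1) ≤ l + 1`. This crude factor is harmless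
only in terms of lower degree. -/
theorem choose_add_succ_le (k l : ℕ) : (k + 1 + l).choose l ≤ (l + 1) * (k + l).choose l := by
  have h := Nat.add_one_mul_choose_eq (k + l) k
  have h1 : (k + l).choose k = (k + l).choose l := by
    rw [Nat.choose_symm_of_eq_add]; omega
  have h2 : (k + l + 1).choose (k + 1) = (k + 1 + l).choose l := by
    rw [show k + l + 1 = k + 1 + l by omega, Nat.choose_symm_of_eq_add]; omega
  rw [h1, h2] at h
  have h3 : (k + 1 + l).choose l * (k + 1) ≤ ((l + 1) * (k + l).choose l) * (k + 1) := by
    rw [← h]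
    nlinarith [Nat.zero_le (k * l * (k + l).choose l)]
  exact Nat.le_of_mul_le_mul_right h3 (by omega)

end Counting

/-! ### The bound on the Hilbert function -/

section Bound

variable {E : Type*} [NormedAddCommGroup E] [NormedSpace ℝ E]

theorem nijenhuisImage_eq {J : E → E →L[ℝ] E} {p : E} (hJ : DifferentiableAt ℝ J p) :
    nijenhuisImage J p =
      Submodule.span ℝ {w | ∃ u v, w = nijenhuisBilin (J p) (fderiv ℝ J p) u v} := by
  simp only [nijenhuisImage, nijenhuisAt_eq hJ]

theorem nijenhuisKernel_eq {J : E → E →L[ℝ] E} {p : E} (hJ : DifferentiableAt ℝ J p) :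
    nijenhuisKernel J p = LinearMap.ker (nijenhuisBilin (J p) (fderiv ℝ J p)) := by
  rw [nijenhuisKernel, ← Submodule.span_eq (LinearMap.ker (nijenhuisBilin (J p) (fderiv ℝ J p)))]
  congr 1
  ext u
  simp only [nijenhuisAt_eq hJ]
  exact ⟨fun h => LinearMap.mem_ker.2 (LinearMap.ext h),
    fun h v => by rw [LinearMap.mem_ker.1 h]; rfl⟩

/-- The bound for a local almost complex structure with nonvanishing Nijenhuis tensor. -/
theorem dependsOnAtMost_hilbertFunction [FiniteDimensional ℝ E] {n : ℕ} (hn : 4 ≤ n)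
    (hE : Module.finrank ℝ E = 2 * n) {J : E → E →L[ℝ] E} {p : E}
    (hJ : ContDiffAt ℝ ∞ J p) (hJ2 : ∀ᶠ q in 𝓝 p, ∀ v, J q (J q v) = -v)
    (hN : ∃ u v : E, nijenhuisAt J p u v ≠ 0)
    {S : Set (E → E)} (hS : S ⊆ formalSymmetries J p) :
    DependsOnAtMost (hilbertFunction S p) (n - 2) (n - 1) ∧
    (¬ DependsOnAtMost (hilbertFunction S p) (n - 3) (n - 1) →
      NijenhuisImageIsComplexLine J p ∧ NijenhuisHasComplexRank J p 2) := by
  have hJd : DifferentiableAt ℝ J p := hJ.differentiableAt (by simp)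
  have hJp : ∀ v, (J p : E →ₗ[ℝ] E) ((J p : E →ₗ[ℝ] E) v) = -v := hJ2.self_of_nhds
  have hbound := fun i (hi : 2 ≤ i) => finrank_symbolSpace_le hJ hJ2 hS hi
  simp only [nijenhuisAt_eq hJd] at hN
  unfold NijenhuisImageIsComplexLine NijenhuisHasComplexRank
  rw [nijenhuisImage_eq hJd, nijenhuisKernel_eq hJd]
  have hNJ : ∀ u v, nijenhuisBilin (J p) (fderiv ℝ J p) ((J p : E →ₗ[ℝ] E) u) v =
      -(J p : E →ₗ[ℝ] E) (nijenhuisBilin (J p) (fderiv ℝ J p) u v) :=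
    nijenhuisBilin_antilinear hJp (fderiv_anticomm hJd hJ2)
  have hskew := nijenhuisBilin_skew (J p) (fderiv ℝ J p)
  set N := nijenhuisBilin (J p) (fderiv ℝ J p)
  set A : E →ₗ[ℝ] E := (J p : E →ₗ[ℝ] E)
  set W := Submodule.span ℝ {w | ∃ u v, w = N u v} with hW
  have hWA : ∀ w ∈ W, A w ∈ W := by
    intro w hw
    have h : W ≤ W.comap A := by
      conv_lhs => rw [hW]
      rw [Submodule.span_le]
      rintro _ ⟨x, y, rfl⟩
      refine Submodule.subset_span ⟨-A x, y, ?_⟩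
      rw [map_neg, LinearMap.neg_apply, hNJ, neg_neg]
    exact h hw
  have hZA : ∀ z ∈ LinearMap.ker N, A z ∈ LinearMap.ker N := by
    intro z hz
    rw [LinearMap.mem_ker] at hz ⊢
    ext y
    simp [hNJ, hz]
  obtain ⟨a, e, ha, he⟩ := exists_complex_generators_mod A hJp W hWA
  obtain ⟨r, f, hr, hf⟩ := exists_complex_generators_mod A hJp (LinearMap.ker N) hZA
  have hWdim := Submodule.finrank_quotient_add_finrank W
  have hZdim := Submodule.finrank_quotient_add_finrank (LinearMap.ker N)
  obtain ⟨u, v, huv⟩ := hN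
  have huvW : N u v ∈ W := Submodule.subset_span ⟨u, v, rfl⟩
  have hWpos : 0 < Module.finrank ℝ W :=
    Module.finrank_pos_iff_exists_ne_zero.2 ⟨⟨N u v, huvW⟩, fun h => huv (congrArg Subtype.val h)⟩
  rw [ha, hE] at hWdim
  rw [hr, hE] at hZdim
  set g : ℕ → ℕ := fun i => Module.finrank ℝ (symbolSpace S p i) with hg
  have hH : ∀ k, hilbertFunction S p k = ∑ i ∈ Finset.range (k + 1), g i := fun k => rfl
  by_cases ha2 : a ≤ n - 2
  · have h0 : DependsOnAtMost (hilbertFunction S p) 0 (n - 1) := by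
      refine dependsOnAtMost_of_le (j := a) (C := g 0 + g 1) (c := n) (by omega) fun k => ?_
      have h1 := sum_range_succ_le_of_le (g := g) (b := fun i => a.multichoose i * (2 * n))
        (fun i hi => (hbound i hi).trans (hE ▸ finrank_annihilatingSymbols_le e he)) k
      rw [← Finset.sum_mul, Nat.sum_range_multichoose, ← hH] at h1
      refine h1.trans (le_of_eq ?_)
      ring
    exact ⟨h0.mono (Nat.zero_le _), fun h => absurd (h0.mono (Nat.zero_le _)) h⟩
  -- As `N ≠ 0`, the complex codimension `a` of `W` is less than `n`, so `W` is a complex line.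
  obtain rfl : a = n - 1 := by omega
  have hW2 : Module.finrank ℝ W = 2 := by omega
  have hline : ∃ w : E, w ≠ 0 ∧ W = Submodule.span ℝ {w, J p w} :=
    ⟨N u v, huv, eq_smul_add_smul_of_finrank_two hJp hW2 hWA huvW huv⟩
  rcases finrank_quotient_ker_eq_four_or hJp hNJ hskew hW2 ⟨u, v, huv⟩ with h4 | h8
  · refine ⟨?_, fun _ => ⟨hline, h4⟩⟩
    obtain rfl : r = 2 := by omega
    -- Here `2 < n - 1` needs `n ≥ 4`; the coefficient `3` is `l + 1` for `l = 2` in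
    -- `choose_add_succ_le`.
    refine dependsOnAtMost_of_le (j := 2) (C := g 0 + g 1) (c := 3) (by omega) fun k => ?_
    have h1 := sum_range_succ_le_of_le (g := g)
      (b := fun i => (n - 1).multichoose i * (2 * (n - 2)) + Nat.multichoose 2 (i + 1) * 2)
      (fun i hi => by
        have h := (hbound i hi).trans (finrank_annihilatingSymbols_le_add hNJ hskew
          (by omega) e he (LinearMap.ker N) (Or.inr le_rfl) f hf)
        rwa [hW2, show Module.finrank ℝ (LinearMap.ker N) = 2 * (n - 2) by omega] at h) k
    rw [Finset.sum_add_distrib, ← Finset.sum_mul, ← Finset.sum_mul, Nat.sum_range_multichoose,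
      ← hH] at h1
    have h2 := (sum_multichoose_succ_le 2 k).trans (choose_add_succ_le k 2)
    calc _ ≤ _ := h1
      _ ≤ g 0 + g 1 + ((k + (n - 1)).choose (n - 1) * (2 * (n - 2))
          + (2 + 1) * (k + 2).choose 2 * 2) := by gcongr
      _ = _ := by ring
  · have h0 : DependsOnAtMost (hilbertFunction S p) (n - 3) (n - 1) := by
      refine dependsOnAtMost_of_le (j := n - 2) (C := g 0 + g 1) (c := n - 1) (by omega)
        fun k => ?_
      have h1 := sum_range_succ_le_of_le (g := g)
        (b := fun i => (n - 1).multichoose i * (2 * (n - 4)) + (n - 1).multichoose (i + 1) * 2)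
        (fun i hi => by
          have h := (hbound i hi).trans (finrank_annihilatingSymbols_le_add hNJ hskew
            (by omega) e he W (Or.inl le_rfl) e he)
          rw [hW2] at h
          refine h.trans ?_
          gcongr
          omega) k
      rw [Finset.sum_add_distrib, ← Finset.sum_mul, ← Finset.sum_mul, Nat.sum_range_multichoose,
        ← hH] at h1
      have h2 := sum_multichoose_succ_le (n - 1) k
      have h3 := choose_add_succ_le k (n - 2)
      -- Pascal's rule isolates the top-degree part with coefficient exactly one, so that the crude
      -- estimate is spent only on the part of degree `n - 2`.
      have h5 : (k + 1 + (n - 1)).choose (n - 1)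
          = (k + 1 + (n - 2)).choose (n - 2) + (k + (n - 1)).choose (n - 1) := by
        obtain ⟨l, rfl⟩ : ∃ l, n = l + 2 := ⟨n - 2, by omega⟩
        rw [show k + 1 + (l + 2 - 1) = (k + 1 + l) + 1 by omega, show l + 2 - 1 = l + 1 by omega,
          show l + 2 - 2 = l by omega, show k + (l + 1) = k + 1 + l by omega,
          Nat.choose_succ_succ]
      rw [h5] at h2
      rw [show n - 2 + 1 = n - 1 by omega] at h3
      have h6 := h2.trans (Nat.add_le_add_right h3 _)
      calc _ ≤ _ := h1
        _ ≤ g 0 + g 1 + ((k + (n - 1)).choose (n - 1) * (2 * (n - 4))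
            + ((n - 1) * (k + (n - 2)).choose (n - 2) + (k + (n - 1)).choose (n - 1)) * 2) := by
          gcongr
        _ = _ := by
          rw [show n - 3 = n - 4 + 1 by omega]
          ring
    exact ⟨h0.mono (by omega), fun h => absurd h0 h⟩

end Bound

theorem mainTheorem6 {n : ℕ} (hn : 4 ≤ n)
    {E : Type*} [NormedAddCommGroup E] [NormedSpace ℝ E] [FiniteDimensional ℝ E]
    (hE : Module.finrank ℝ E = 2 * n)
    {M : Type*} [TopologicalSpace M] [ChartedSpace E M] [IsManifold 𝓘(ℝ, E) ∞ M]
    (J : AlmostComplexStructure E M) (x : M)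
    (hN : ∃ u v : E, nijenhuisAt (J.inChart x) (extChartAt 𝓘(ℝ, E) x x) u v ≠ 0)
    (S : Set (E → E))
    (hS : S = localSymmetries (J.inChart x) (extChartAt 𝓘(ℝ, E) x x) ∨
      S = formalSymmetries (J.inChart x) (extChartAt 𝓘(ℝ, E) x x)) :
    DependsOnAtMost (hilbertFunction S (extChartAt 𝓘(ℝ, E) x x)) (n - 2) (n - 1) ∧
    (¬ DependsOnAtMost (hilbertFunction S (extChartAt 𝓘(ℝ, E) x x)) (n - 3) (n - 1) →
      NijenhuisImageIsComplexLine (J.inChart x) (extChartAt 𝓘(ℝ, E) x x) ∧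
      NijenhuisHasComplexRank (J.inChart x) (extChartAt 𝓘(ℝ, E) x x) 2) := by
  refine dependsOnAtMost_hilbertFunction hn hE (J.contDiffAt_inChart x) (J.inChart_sq x) hN ?_
  rcases hS with rfl | rfl
  · exact localSymmetries_subset_formalSymmetries _ _
  · exact Subset.rfl
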